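/- Graphs are finite; parallel edges are allowed. For positive integers $q,q'$, a graph is called a $(q,q')$-semi-regular bipartite graph with parts $V,V'$ if its vertex set is the disjoint union of the non-empty sets $V,V'$, every edge joins a vertex of $V$ to a vertex of $V'$, every vertex of $V$ has degree $q$ and every vertex of $V'$ has degree $q'$. Let $G_1$ be a $(q_1,q_2)$-semi-regular bipartite graph with parts $V_1,V_2$ and let $G_2$ be a $(q_3,q_4)$-semi-regular bipartite graph with parts $V_3,V_4$. Put $n_i=|V_i|$ for $1\le i\le 4$, $\nu_1=n_1+n_2$ and $\nu_2=n_3+n_4$. Let $\lambda_1\ge\lambda_2\ge\cdots\ge\lambda_{k_1}$ and $\mu_1\ge\mu_2\ge\cdots\ge\mu_{k_2}$ be all the positive eigenvalues, listed with multiplicity, of the adjacency matrices of $G_1$ and of $G_2$ respectively (the $(x,y)$ entry of the adjacency matrix is the number of edges joining $x$ and $y$). Let $G=G_1\vee G_2$ be the join, that is, the disjoint union of $G_1$ and $G_2$ together with one new edge $uv$ for every vertex $u$ of $G_1$ and every vertex $v$ of $G_2$. Then $k_1\le\min(n_1,n_2)$ and $k_2\le\min(n_3,n_4)$, and the number $\tau(G)$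 of spanning trees of $G$ is $$\begin{aligned}\tau(G)={}&(q_1+q_2+\nu_2)(q_3+q_4+\nu_1)\\&\cdot(q_1+\nu_2)^{n_1-k_1}(q_2+\nu_2)^{n_2-k_1}(q_3+\nu_1)^{n_3-k_2}(q_4+\nu_1)^{n_4-k_2}\\&\cdot\prod_{i=2}^{k_1}\bigl[(q_1+\nu_2)(q_2+\nu_2)-\lambda_i^2\bigr]\prod_{j=2}^{k_2}\bigl[(q_3+\nu_1)(q_4+\nu_1)-\mu_j^2\bigr].\end{aligned}$$ -/

import Mathlib

/-! Graphs are multigraphs (`Graph α β`): parallel edges are allowed, and the adjacency matrix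
counts edges. -/

namespace Graph

/-- The degree of a vertex: the number of incident edges, each loop counting as two edges. -/
noncomputable def degree {α β : Type*} (G : Graph α β) (x : α) : ℕ :=
  {e | G.IsNonloopAt e x}.ncard + 2 * {e | G.IsLoopAt e x}.ncard

/-- The adjacency matrix of a multigraph: the entry at `(x, y)` is the number of edges joining
`x` and `y`, each loop counting as two edges. -/
noncomputable def adjacencyMatrix {α β : Type*} [DecidableEq α] (G : Graph α β) :
    Matrix G.vertexSet G.vertexSet ℝ :=
  Matrix.of fun x y =>
    if x = y then 2 * ({e | G.IsLoopAt e x}.ncard : ℝ) else ({e | G.IsLink e x y}.ncard : ℝ)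

/-- The links of the join: the edges of `G`, the edges of `H`, and for each vertex `u` of `G` and
each vertex `v` of `H` one new edge, labelled `(u, v)`, with ends `u` and `v`. -/
inductive JoinLink {α₁ β₁ α₂ β₂ : Type*} (G : Graph α₁ β₁) (H : Graph α₂ β₂) :
    β₁ ⊕ β₂ ⊕ (α₁ × α₂) → α₁ ⊕ α₂ → α₁ ⊕ α₂ → Prop
  | left {e : β₁} {x y : α₁} (h : G.IsLink e x y) :
      JoinLink G H (Sum.inl e) (Sum.inl x) (Sum.inl y)
  | right {e : β₂} {x y : α₂} (h : H.IsLink e x y) :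
      JoinLink G H (Sum.inr (Sum.inl e)) (Sum.inr x) (Sum.inr y)
  | cross {u : α₁} {v : α₂} (hu : u ∈ G.vertexSet) (hv : v ∈ H.vertexSet) :
      JoinLink G H (Sum.inr (Sum.inr (u, v))) (Sum.inl u) (Sum.inr v)
  | cross' {u : α₁} {v : α₂} (hu : u ∈ G.vertexSet) (hv : v ∈ H.vertexSet) :
      JoinLink G H (Sum.inr (Sum.inr (u, v))) (Sum.inr v) (Sum.inl u)

/-- The join `G ∨ H`: the disjoint union of `G` and `H` together with one new edge between `u` and
`v` for every vertex `u` of `G` and every vertex `v` of `H`. -/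
def join {α₁ β₁ α₂ β₂ : Type*} (G : Graph α₁ β₁) (H : Graph α₂ β₂) :
    Graph (α₁ ⊕ α₂) (β₁ ⊕ β₂ ⊕ (α₁ × α₂)) where
  vertexSet := Sum.inl '' G.vertexSet ∪ Sum.inr '' H.vertexSet
  IsLink := JoinLink G H
  isLink_symm := by
    intro e _
    refine ⟨fun x y h => ?_⟩
    cases h with
    | left h => exact .left h.symm
    | right h => exact .right h.symm
    | cross hu hv => exact .cross' hu hv
    | cross' hu hv => exact .cross hu hv
  eq_or_eq_of_isLink_of_isLink := by
    intro e x y v w h h'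
    cases h with
    | left h => cases h' with
      | left h' => simpa using h.left_eq_or_eq h'
    | right h => cases h' with
      | right h' => simpa using h.left_eq_or_eq h'
    | cross hu hv => cases h' <;> simp
    | cross' hu hv => cases h' <;> simp
  left_mem_of_isLink := by
    intro e x y h
    cases h with
    | left h => simpa using h.left_mem
    | right h => simpa using h.left_mem
    | cross hu hv => simpa using hu
    | cross' hu hv => simpa using hv

/-- `T` is a spanning tree of `G`: a subgraph with the same vertex set (and a subset of the edges
of `G`) which has no loops and no parallel edges and is a tree as a simple graph. -/
def IsSpanningTree {α β : Type*} (T G : Graph α β) : Prop :=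
  T ≤s G ∧ T.Simple ∧ T.toSimpleGraph.IsTree

/-- The number of spanning trees of `G`. -/
noncomputable def numSpanningTrees {α β : Type*} (G : Graph α β) : ℕ :=
  {T : Graph α β | T.IsSpanningTree G}.ncard

/-- `G` is a `(p, q)`-semi-regular bipartite graph with parts `A` and `B`: the vertex set is the
disjoint union of the non-empty sets `A` and `B`, each edge has one end in `A` and the other in
`B`, each vertex of `A` has degree `p` and each vertex of `B` has degree `q`. -/
structure IsSemiregularBipartite {α β : Type*} (G : Graph α β) (A B : Set α) (p q : ℕ) :
    Prop where
  union_eq : A ∪ B = G.vertexSet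
  disjoint : Disjoint A B
  nonempty_left : A.Nonempty
  nonempty_right : B.Nonempty
  bipartite : ∀ e x y, G.IsLink e x y → (x ∈ A ∧ y ∈ B) ∨ (x ∈ B ∧ y ∈ A)
  degree_left : ∀ x ∈ A, G.degree x = p
  degree_right : ∀ x ∈ B, G.degree x = q

/-- `lam 1 ≥ lam 2 ≥ ⋯ ≥ lam k` is the list of all positive eigenvalues of the adjacency matrix
of `G`, with multiplicity (values of `lam` outside `1, …, k` are irrelevant). -/
def HasPositiveEigenvalues {α β : Type*} [DecidableEq α] (G : Graph α β) [Fintype G.vertexSet]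
    (k : ℕ) (lam : ℕ → ℝ) : Prop :=
  AntitoneOn lam (Set.Icc 1 k) ∧
    G.adjacencyMatrix.charpoly.roots.filter (fun t => 0 < t) = (Finset.Icc 1 k).val.map lam

end Graph

/-! Write `L` for a Laplacian, `J` for the all-ones matrix, and let `G₁`, `G₂` have orders `m`, `n`.
The matrix-tree theorem is proved in the form `det (L + E_rr) = τ`, which for a Laplacian is
equivalent to `det (L + J) = |V|² τ`. The second form suits joins: adding `J` to the Laplacian of
the join cancels the off-diagonal blocks `-1` and leaves the diagonal blocks `L₁ + n + J` and `L₂ +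
m + J`. Since `L₁` kills the constant vector, `det (L₁ + n + J) = (1 + m/n) det (L₁ + n)`, and
symmetrically for `L₂`. Hence `m n τ(G) = det (L₁ + n) det (L₂ + m)` (`numSpanningTrees_join`).

For a semiregular bipartite graph, `L + c` is `D - A` with `D` equal to `a = p + c` on one part and
`b = q + c` on the other. A diagonal scaling turns it into `t - A` with `t² = ab`, so the
determinant is a value of the characteristic polynomial. The spectrum of `A` is symmetric about
zero, so this value is a product of factors `ab - λ²` over the positive eigenvalues, times powers of
`a` and `b` (`det_diagonal_sub_eq_of_bipartite`). The largest eigenvalue is `√(pq)`, by a positive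
eigenvector; its factor is `ab - pq = c (p + q + c)`. The two factors `c` are `n` and `m`, and they
cancel the `m n` above. -/

/-! ### Cauchy–Binet as a sum over all maps. -/

-- A non-injective `f` repeats a column and contributes zero, and each set of columns is hit by
-- `(card m)!` injective maps. Summing over maps rather than subsets avoids ordering the columns.
open Matrix in
theorem Matrix.factorial_card_mul_det_mul_transpose {m n R : Type*} [Fintype m] [DecidableEq m]
    [Fintype n] [DecidableEq n] [CommRing R] (M : Matrix m n R) :
    ((Fintype.card m).factorial : R) * (M * Mᵀ).det =
      ∑ f : m → n, (M.submatrix id f).det ^ 2 := by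
  have expand : (M * Mᵀ).det = ∑ f : m → n, (∏ i, M i (f i)) * (M.submatrix id f).det := by
    have h : (M * Mᵀ) = fun i => ∑ e, M i e • Mᵀ e := by
      ext i j
      simp [Matrix.mul_apply]
    rw [h]
    change (detRowAlternating : (m → R) [⋀^m]→ₗ[R] R).toMultilinearMap (fun i => ∑ e, M i e • Mᵀ e) = _
    rw [MultilinearMap.map_sum]
    refine Finset.sum_congr rfl fun f _ => ?_
    rw [MultilinearMap.map_smul_univ, smul_eq_mul, ← det_transpose (M.submatrix id f)]
    rfl
  have key : ∀ σ : Equiv.Perm m, ∑ f : m → n,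
      ((Equiv.Perm.sign σ : ℤ) : R) * (∏ i, M (σ i) (f i)) * (M.submatrix id f).det =
        (M * Mᵀ).det := by
    intro σ
    -- Replacing `f` by `f ∘ σ` permutes the columns of the minor; the resulting sign cancels the
    -- one already present.
    rw [expand, ← Equiv.sum_comp (Equiv.arrowCongr σ.symm (Equiv.refl n))]
    refine Finset.sum_congr rfl fun f _ => ?_
    have h1 : ∏ i, M (σ i) ((Equiv.arrowCongr σ.symm (Equiv.refl n)) f i) = ∏ i, M i (f i) := by
      simpa using Equiv.prod_comp σ (fun i => M i (f i))
    have h2 : M.submatrix id ((Equiv.arrowCongr σ.symm (Equiv.refl n)) f) =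
        (M.submatrix id f).submatrix id σ := by
      ext i j
      simp
    have h3 : ((Equiv.Perm.sign σ : ℤ) : R) * ((Equiv.Perm.sign σ : ℤ) : R) = 1 := by
      rw [← Int.cast_mul, Int.units_coe_mul_self, Int.cast_one]
    rw [h1, h2, det_permute']
    linear_combination (∏ i, M i (f i)) * (M.submatrix id f).det * h3
  have h : ∀ f : m → n, (M.submatrix id f).det ^ 2 = ∑ σ : Equiv.Perm m,
      ((Equiv.Perm.sign σ : ℤ) : R) * (∏ i, M (σ i) (f i)) * (M.submatrix id f).det := by
    intro f
    rw [← Finset.sum_mul, sq, det_apply' (M.submatrix id f)]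
    rfl
  rw [Finset.sum_congr rfl fun f _ => h f, Finset.sum_comm, Finset.sum_congr rfl fun σ _ => key σ]
  simp [Fintype.card_perm]

/-! ### Minors of the rooted incidence matrix. -/

namespace OrientedMultigraph

variable {V E : Type*} [DecidableEq V] (s t : E → V)

/-- The signed incidence matrix of edges with sources `s` and targets `t`. -/
def incidence : Matrix V E ℤ :=
  Matrix.of fun v e => Pi.single (M := fun _ => ℤ) (s e) 1 v - Pi.single (M := fun _ => ℤ) (t e) 1 v

/-- The signed incidence matrix with one more column, the indicator of the root `r`. -/
def rootedIncidence (r : V) : Matrix V (Option E) ℤ :=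
  Matrix.of fun v o => o.elim (Pi.single (M := fun _ => ℤ) r 1 v) (incidence s t v)

/-- The simple graph in which the ends of each edge in `S` are adjacent. -/
def support (S : Set E) : SimpleGraph V :=
  SimpleGraph.fromRel fun u v => ∃ e ∈ S, s e = u ∧ t e = v

variable {s t}

theorem reachable_support {S : Set E} {e : E} (he : e ∈ S) :
    (support s t S).Reachable (s e) (t e) := by
  by_cases h : s e = t e
  · rw [h]
  · exact SimpleGraph.Adj.reachable ⟨h, Or.inl ⟨e, he, rfl, rfl⟩⟩

theorem rootedIncidence_mul_transpose [Fintype E] (r : V) :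
    rootedIncidence s t r * (rootedIncidence s t r).transpose =
      incidence s t * (incidence s t).transpose + Matrix.single r r 1 := by
  ext x y
  simp only [Matrix.mul_apply, Fintype.sum_option, Matrix.transpose_apply, rootedIncidence,
    Matrix.of_apply, Option.elim, Matrix.add_apply, Matrix.single_apply]
  rw [add_comm]
  congr 1
  by_cases hx : r = x <;> by_cases hy : r = y <;> simp [Pi.single_apply, hx, hy, eq_comm]

variable [Fintype V]

/-- The columns span `ℤ^V`: the root column is the basis vector at `r`, and an edge column carries
the basis vector at one end to that at the other, hence along any walk. So there is an integral
right inverse and the determinant is a unit. -/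
theorem sq_det_rootedIncidence_eq_one {r : V} {f : V → Option E} (hr : none ∈ Set.range f)
    (hf : (support s t {e | some e ∈ Set.range f}).Connected) :
    ((rootedIncidence s t r).submatrix id f).det ^ 2 = 1 := by
  set M := (rootedIncidence s t r).submatrix id f with hM
  have col : ∀ i, M.mulVec (Pi.single i 1) = fun v => rootedIncidence s t r v (f i) := by
    intro i
    ext v
    simp [hM]
  have edge : ∀ e, some e ∈ Set.range f → ∃ p, M.mulVec p = Pi.single (s e) 1 - Pi.single (t e) 1 := by
    rintro e ⟨i, hi⟩
    refine ⟨_, (col i).trans ?_⟩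
    ext v
    simp [hi, rootedIncidence, incidence]
  have step : ∀ u v, (support s t {e | some e ∈ Set.range f}).Adj u v →
      (∃ p, M.mulVec p = Pi.single u 1) → ∃ p, M.mulVec p = Pi.single v 1 := by
    rintro u v ⟨-, ⟨e, he, rfl, rfl⟩ | ⟨e, he, rfl, rfl⟩⟩ ⟨p, hp⟩
    · obtain ⟨p', hp'⟩ := edge e he
      exact ⟨p - p', by rw [Matrix.mulVec_sub, hp, hp']; simp⟩
    · obtain ⟨p', hp'⟩ := edge e he
      exact ⟨p + p', by rw [Matrix.mulVec_add, hp, hp']; simp⟩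
  have all : ∀ v, ∃ p, M.mulVec p = Pi.single v 1 := by
    intro v
    have h0 : ∃ p, M.mulVec p = Pi.single r 1 := by
      obtain ⟨i, hi⟩ := hr
      refine ⟨_, (col i).trans ?_⟩
      ext v
      simp [hi, rootedIncidence]
    obtain ⟨w⟩ := hf.preconnected r v
    generalize r = r' at w h0
    induction w with
    | nil => exact h0
    | cons hadj _ ih => exact ih (step _ _ hadj h0)
  choose p hp using all
  have hprod : M * Matrix.of (fun i v => p v i) = 1 := by
    ext i v
    have := congrFun (hp v) i
    simp only [Matrix.mulVec, dotProduct] at this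
    simp [Matrix.mul_apply, this, Matrix.one_apply, Pi.single_apply]
  have hdet := congrArg Matrix.det hprod
  rw [Matrix.det_mul, Matrix.det_one] at hdet
  exact Int.isUnit_sq (IsUnit.of_mul_eq_one _ hdet)

/-- The indicator row vector of a set `C` kills every edge column that does not cross the boundary
of `C`. Take `C` to be the vertices not reachable from `r`, or all of `V` if the root column is
absent. -/
theorem det_rootedIncidence_eq_zero {r : V} {f : V → Option E}
    (hf : none ∉ Set.range f ∨ ¬ (support s t {e | some e ∈ Set.range f}).Connected) :
    ((rootedIncidence s t r).submatrix id f).det = 0 := by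
  classical
  have key : ∀ C : Set V, (∃ v, v ∈ C) → (∀ e, some e ∈ Set.range f → (s e ∈ C ↔ t e ∈ C)) →
      (none ∈ Set.range f → r ∉ C) → ((rootedIncidence s t r).submatrix id f).det = 0 := by
    rintro C ⟨v, hv⟩ hC hr
    rw [← Matrix.exists_vecMul_eq_zero_iff]
    refine ⟨fun x => if x ∈ C then 1 else 0, fun h => by simpa [hv] using congrFun h v, ?_⟩
    ext i
    rcases hi : f i with _ | e
    · simpa [Matrix.vecMul, dotProduct, rootedIncidence, hi, Pi.single_apply] using hr ⟨i, hi⟩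
    · simp [Matrix.vecMul, dotProduct, rootedIncidence, incidence, hi, mul_sub, Pi.single_apply,
        hC e ⟨i, hi⟩]
  by_cases hn : none ∈ Set.range f
  · have hcon := hf.resolve_left (not_not.mpr hn)
    have : ∃ v, ¬ (support s t {e | some e ∈ Set.range f}).Reachable r v := by
      by_contra! h
      have : Nonempty V := ⟨r⟩
      exact hcon ⟨fun u v => (h u).symm.trans (h v)⟩
    refine key {v | ¬ (support s t {e | some e ∈ Set.range f}).Reachable r v} this
      (fun e he => not_congr ?_) fun _ => by simp
    have he' := reachable_support (s := s) (t := t) (S := {e | some e ∈ Set.range f}) he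
    exact ⟨fun h => h.trans he', fun h => h.trans he'.symm⟩
  · exact key Set.univ ⟨r, trivial⟩ (by simp) (fun h => absurd h hn)

/-- In the Cauchy–Binet sum every square is 0 or 1, and an admissible edge set `S` arises from
exactly the bijections of `V` with `S` plus the root column. This explains both the `+ 1` in the
cardinality condition and the factorial that cancels. -/
theorem det_incidence_mul_transpose_add_single [Fintype E] (r : V) :
    (incidence s t * (incidence s t).transpose + Matrix.single r r 1).det =
      ({S : Finset E | (support s t (S : Set E)).Connected ∧
        S.card + 1 = Fintype.card V}.ncard : ℤ) := by
  classical
  have hfac : ((Fintype.card V).factorial : ℤ) ≠ 0 := by positivity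
  apply mul_left_cancel₀ hfac
  rw [← rootedIncidence_mul_transpose, Matrix.factorial_card_mul_det_mul_transpose]
  set good : (V → Option E) → Prop := fun f => none ∈ Set.range f ∧
    (support s t {e | some e ∈ Set.range f}).Connected with hgood
  have hsq : ∀ f, ((rootedIncidence s t r).submatrix id f).det ^ 2 = if good f then 1 else 0 := by
    intro f
    split_ifs with h
    · exact sq_det_rootedIncidence_eq_one h.1 h.2
    · rw [det_rootedIncidence_eq_zero, zero_pow two_ne_zero]
      rw [hgood] at h
      tauto
  -- A repeated column would make the determinant 0, while its square is 1.
  have hinj : ∀ f, good f → Function.Injective f := by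
    intro f hf
    by_contra h
    simp only [Function.Injective, not_forall] at h
    obtain ⟨i, j, hij, hne⟩ := h
    have h0 := Matrix.det_zero_of_column_eq (M := (rootedIncidence s t r).submatrix id f) hne
      (fun k => by simp [hij])
    have := hsq f
    simp [h0, hf] at this
  set trees : Finset (Finset E) := Finset.univ.filter
    fun S => (support s t (S : Set E)).Connected ∧ S.card + 1 = Fintype.card V with htrees
  have hncard : {S : Finset E | (support s t (S : Set E)).Connected ∧
      S.card + 1 = Fintype.card V}.ncard = trees.card := by
    rw [← Set.ncard_coe_finset]
    simp [htrees]
  rw [Finset.sum_congr rfl fun f _ => hsq f, Finset.sum_boole, hncard, ← Nat.cast_mul,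
    Nat.cast_inj, mul_comm]
  set edges : (V → Option E) → Finset E := fun f => Finset.univ.filter fun e => some e ∈ Set.range f
    with hedges
  have hins : ∀ f, none ∈ Set.range f → Finset.insertNone (edges f) = Finset.univ.image f := by
    intro f hf
    ext o
    cases o with
    | none => simpa using hf
    | some e => simp [hedges]
  have hcoe : ∀ f, (edges f : Set E) = {e | some e ∈ Set.range f} := by
    intro f
    simp [hedges]
  have hmaps : ∀ f ∈ Finset.univ.filter good, edges f ∈ trees := by
    intro f hf
    have hf := (Finset.mem_filter.mp hf).2
    refine Finset.mem_filter.mpr ⟨Finset.mem_univ _, by rw [hcoe]; exact hf.2, ?_⟩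
    rw [← Finset.card_insertNone, hins f hf.1, Finset.card_image_of_injective _ (hinj f hf)]
    rfl
  have hfiber : ∀ S ∈ trees, ((Finset.univ.filter good).filter fun f => edges f = S).card =
      (Fintype.card V).factorial := by
    intro S hS
    obtain ⟨hconn, hcard⟩ := (Finset.mem_filter.mp hS).2
    have e : V ≃ ↥(Finset.insertNone S) := 
      Fintype.equivOfCardEq (by rw [Fintype.card_coe, Finset.card_insertNone, hcard])
    rw [← Fintype.card_equiv e, ← Finset.card_univ,
      ← Finset.card_image_of_injective (f := fun (g : V ≃ ↥(Finset.insertNone S)) v =>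
        (g v : Option E)) Finset.univ
        (fun g g' h => Equiv.ext fun v => Subtype.ext (congrFun h v))]
    congr 1
    ext f
    simp only [Finset.mem_filter, Finset.mem_univ, true_and, Finset.mem_image]
    constructor
    · rintro ⟨hf, rfl⟩
      have hmem : ∀ v, f v ∈ Finset.insertNone (edges f) := by
        intro v
        rw [hins f hf.1]
        exact Finset.mem_image_of_mem f (Finset.mem_univ v)
      refine ⟨Equiv.ofBijective (fun v => ⟨f v, hmem v⟩) ⟨fun u v h => hinj f hf (by simpa using h),
        ?_⟩, rfl⟩
      rintro ⟨o, ho⟩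
      rw [hins f hf.1] at ho
      obtain ⟨v, -, rfl⟩ := Finset.mem_image.mp ho
      exact ⟨v, rfl⟩
    · rintro ⟨g, rfl⟩
      have hrange : ∀ o, o ∈ Set.range (fun v => (g v : Option E)) ↔ o ∈ Finset.insertNone S := by
        intro o
        constructor
        · rintro ⟨v, rfl⟩
          exact (g v).2
        · intro ho
          exact ⟨g.symm ⟨o, ho⟩, by simp⟩
      have hS' : {e | some e ∈ Set.range (fun v => (g v : Option E))} = (S : Set E) := by
        ext e
        rw [Set.mem_ofPred_eq, hrange]
        simp
      exact ⟨⟨(hrange none).mpr (by simp), by rw [hS']; exact hconn⟩,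
        Finset.coe_injective (by rw [hcoe, hS'])⟩
  rw [Finset.card_eq_sum_card_fiberwise hmaps, Finset.sum_congr rfl hfiber, Finset.sum_const,
    smul_eq_mul]

end OrientedMultigraph

/-! ### The matrix-tree theorem for multigraphs. -/

namespace Graph

variable {α β : Type*}

/-- Choosing one edge of `T` for each adjacency gives an injection `φ` from simple edges to edges. A
connected simple graph already needs `|V| - 1` edges, so when `T` has only that many, `φ` is onto
and there is no room for loops or parallel edges. -/
theorem simple_and_isTree_iff (T : Graph α β) [Finite T.vertexSet] (hE : T.edgeSet.Finite) :
    T.Simple ∧ T.toSimpleGraph.IsTree ↔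
      T.toSimpleGraph.Connected ∧ T.edgeSet.ncard + 1 = Nat.card T.vertexSet := by
  have hex : ∀ a : T.toSimpleGraph.edgeSet, ∃ e : T.edgeSet, ∃ x y : T.vertexSet, x ≠ y ∧
      a.1 = s(x, y) ∧ T.IsLink e x y := by
    rintro ⟨a, ha⟩
    induction a with
    | h x y =>
      obtain ⟨hne, e, he⟩ := ha
      exact ⟨⟨e, he.edge_mem⟩, x, y, hne, rfl, he⟩
  choose φ x y hne ha hlink using hex
  have hφ : Function.Injective φ := by
    intro a b hab
    have h1 := hlink a
    rw [hab] at h1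
    rcases h1.eq_and_eq_or_eq_and_eq (hlink b) with ⟨h2, h3⟩ | ⟨h2, h3⟩
    · exact Subtype.ext (by rw [ha, ha, Subtype.ext h2, Subtype.ext h3])
    · exact Subtype.ext (by rw [ha, ha, Subtype.ext h2, Subtype.ext h3, Sym2.eq_swap])
  have : Finite T.edgeSet := hE
  have hcard : Nat.card T.edgeSet = T.edgeSet.ncard := rfl
  have hle := Nat.card_le_card_of_injective φ hφ
  constructor
  · rintro ⟨hs, ht⟩
    refine ⟨ht.connected, ?_⟩
    rw [SimpleGraph.isTree_iff_connected_and_card] at ht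
    rw [← ht.2, ← hcard, Nat.card_congr (Equiv.ofBijective φ ⟨hφ, ?_⟩)]
    rintro ⟨e, he⟩
    obtain ⟨u, v, huv⟩ := exists_isLink_of_mem_edgeSet he
    let a : T.toSimpleGraph.edgeSet := ⟨s(⟨u, huv.left_mem⟩, ⟨v, huv.right_mem⟩),
      fun h => huv.ne (congrArg Subtype.val h), e, huv⟩
    refine ⟨a, Subtype.ext ?_⟩
    have h1 := hlink a
    have h2 := ha a
    rcases Sym2.eq_iff.mp h2 with ⟨h3, h4⟩ | ⟨h3, h4⟩
    · rw [← h3, ← h4] at h1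
      exact h1.eq huv
    · rw [← h3, ← h4] at h1
      exact h1.eq huv.symm
  · rintro ⟨hc, hn⟩
    have h1 := hc.card_vert_le_card_edgeSet_add_one
    have h2 : Nat.card T.toSimpleGraph.edgeSet = Nat.card T.edgeSet := by omega
    have hsurj : Function.Surjective φ :=
      (hφ.bijective_of_nat_card_le h2.ge).2
    -- Every edge is now a chosen representative: its ends differ, and two edges with the same ends
    -- represent the same simple edge.
    refine ⟨{ not_isLoopAt := fun e u he => ?_, eq_of_isLink := fun e f u v he hf => ?_ }, ?_⟩
    · obtain ⟨a, h⟩ := hsurj ⟨e, he.edge_mem⟩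
      have h3 := hlink a
      rw [h] at h3
      rcases he.eq_and_eq_or_eq_and_eq h3 with ⟨h4, h5⟩ | ⟨h4, h5⟩ <;>
        exact hne a (Subtype.ext (by rw [← h4, ← h5]))
    · obtain ⟨a, h⟩ := hsurj ⟨e, he.edge_mem⟩
      obtain ⟨b, h'⟩ := hsurj ⟨f, hf.edge_mem⟩
      have h3 := hlink a
      have h4 := hlink b
      rw [h] at h3
      rw [h'] at h4
      suffices a = b by
        rw [this, h'] at h
        exact (congrArg Subtype.val h).symm
      have h5 : s((x a : α), (y a : α)) = s((x b : α), (y b : α)) :=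
        (h3.isLink_iff_sym2_eq.mp he).trans (h4.isLink_iff_sym2_eq.mp hf).symm
      refine Subtype.ext ?_
      rw [ha, ha]
      simpa [Subtype.ext_iff] using h5
    · rw [SimpleGraph.isTree_iff_connected_and_card]
      exact ⟨hc, by omega⟩

/-- The Laplacian matrix of a multigraph: its loops do not contribute. -/
noncomputable def laplacianMatrix [DecidableEq α] (G : Graph α β) :
    Matrix G.vertexSet G.vertexSet ℤ :=
  Matrix.of fun x y =>
    if x = y then ({e | G.IsNonloopAt e x}.ncard : ℤ) else -({e | G.IsLink e x y}.ncard : ℤ)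

theorem sum_edgeSet_boole (G : Graph α β) [Fintype G.edgeSet] (P : β → Prop) [DecidablePred P]
    (hP : ∀ e, P e → e ∈ G.edgeSet) :
    ∑ e : G.edgeSet, (if P e then (1 : ℤ) else 0) = {e | P e}.ncard := by
  rw [Finset.sum_boole, Nat.cast_inj, ← Set.ncard_coe_finset,
    ← Set.ncard_image_of_injective _ Subtype.val_injective]
  congr 1
  ext e
  simpa using hP e

theorem incidence_mul_transpose_eq_laplacianMatrix [DecidableEq α] (G : Graph α β)
    [Fintype G.edgeSet] {s t : G.edgeSet → G.vertexSet} (hst : ∀ e : G.edgeSet, G.IsLink e (s e) (t e)) :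
    OrientedMultigraph.incidence s t * (OrientedMultigraph.incidence s t).transpose =
      G.laplacianMatrix := by
  classical
  ext x y
  have hlink : ∀ (e : G.edgeSet) (x y : G.vertexSet),
      G.IsLink e x y ↔ (s e = x ∧ t e = y) ∨ (s e = y ∧ t e = x) := by
    intro e x y
    rw [(hst e).isLink_iff]
    simp only [Subtype.ext_iff, eq_comm (b := (x : α)), eq_comm (b := (y : α))]
  simp only [Matrix.mul_apply, Matrix.transpose_apply, laplacianMatrix, Matrix.of_apply,
    OrientedMultigraph.incidence, Pi.single_apply]
  split_ifs with h
  · subst h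
    rw [← sum_edgeSet_boole G (fun e => G.IsNonloopAt e x) fun e he => he.edge_mem]
    refine Finset.sum_congr rfl fun e _ => ?_
    have : G.IsNonloopAt e x ↔ (s e = x ∧ t e ≠ x) ∨ (t e = x ∧ s e ≠ x) := by
      constructor
      · rintro ⟨z, hz, hl⟩
        have := (hlink e x ⟨z, hl.right_mem⟩).mp hl
        have hz' : (⟨z, hl.right_mem⟩ : G.vertexSet) ≠ x := fun h => hz (congrArg Subtype.val h)
        rcases this with ⟨h1, h2⟩ | ⟨h1, h2⟩
        · exact Or.inl ⟨h1, h2 ▸ hz'⟩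
        · exact Or.inr ⟨h2, h1 ▸ hz'⟩
      · rintro (⟨h1, h2⟩ | ⟨h1, h2⟩)
        · exact ⟨t e, fun h => h2 (Subtype.ext h), (hlink _ _ _).mpr (Or.inl ⟨h1, rfl⟩)⟩
        · exact ⟨s e, fun h => h2 (Subtype.ext h), (hlink _ _ _).mpr (Or.inr ⟨rfl, h1⟩)⟩
    by_cases h1 : s e = x <;> by_cases h2 : t e = x <;> simp [this, h1, h2, eq_comm (a := x)]
  · rw [← sum_edgeSet_boole G (fun e => G.IsLink e x y) fun e he => he.edge_mem,
      ← Finset.sum_neg_distrib]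
    refine Finset.sum_congr rfl fun e _ => ?_
    simp only [hlink, eq_comm (a := x), eq_comm (a := y)]
    by_cases h1 : s e = x <;> by_cases h2 : t e = x
    · simp [h1, h2, h]
    · by_cases h4 : t e = y <;> simp [h1, h2, h4, h, Ne.symm h]
    · by_cases h4 : s e = y <;> simp [h1, h2, h4, h, Ne.symm h]
    · simp [h1, h2]

theorem restrict_toSimpleGraph (G : Graph α β) {s t : G.edgeSet → G.vertexSet}
    (hst : ∀ e : G.edgeSet, G.IsLink e (s e) (t e)) (S : Set G.edgeSet) :
    (G.restrict (Subtype.val '' S)).toSimpleGraph = OrientedMultigraph.support s t S := by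
  ext x y
  change (x ≠ y ∧ ∃ e, e ∈ Subtype.val '' S ∧ G.IsLink e x y) ↔
    (x ≠ y ∧ ((∃ e ∈ S, s e = x ∧ t e = y) ∨ ∃ e ∈ S, s e = y ∧ t e = x))
  refine and_congr_right fun _ => ⟨?_, ?_⟩
  · rintro ⟨_, ⟨e, he, rfl⟩, hl⟩
    rcases hl.eq_and_eq_or_eq_and_eq (hst e) with ⟨h1, h2⟩ | ⟨h1, h2⟩
    · exact Or.inl ⟨e, he, (Subtype.ext h1).symm, (Subtype.ext h2).symm⟩
    · exact Or.inr ⟨e, he, (Subtype.ext h2).symm, (Subtype.ext h1).symm⟩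
  · rintro (⟨e, he, rfl, rfl⟩ | ⟨e, he, rfl, rfl⟩)
    · exact ⟨e, ⟨e, he, rfl⟩, hst e⟩
    · exact ⟨e, ⟨e, he, rfl⟩, (hst e).symm⟩

theorem numSpanningTrees_eq_ncard (G : Graph α β) [Fintype G.vertexSet] [Fintype G.edgeSet]
    {s t : G.edgeSet → G.vertexSet} (hst : ∀ e : G.edgeSet, G.IsLink e (s e) (t e)) :
    G.numSpanningTrees = {S : Finset G.edgeSet |
      (OrientedMultigraph.support s t (S : Set G.edgeSet)).Connected ∧
        S.card + 1 = Fintype.card G.vertexSet}.ncard := by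
  classical
  have hedge : ∀ S : Finset G.edgeSet,
      (G.restrict (Subtype.val '' (S : Set G.edgeSet))).edgeSet = Subtype.val '' (S : Set G.edgeSet) := by
    intro S
    simp
  have hinj : Function.Injective
      fun S : Finset G.edgeSet => G.restrict (Subtype.val '' (S : Set G.edgeSet)) := by
    intro S S' h
    have := congrArg Graph.edgeSet h
    simp only [hedge] at this
    exact Finset.coe_injective (Subtype.val_injective.image_injective this)
  rw [← Set.ncard_image_of_injective _ hinj, numSpanningTrees]
  congr 1
  have hiff : ∀ S : Finset G.edgeSet,
      (G.restrict (Subtype.val '' (S : Set G.edgeSet))).IsSpanningTree G ↔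
      (OrientedMultigraph.support s t (S : Set G.edgeSet)).Connected ∧
        S.card + 1 = Fintype.card G.vertexSet := by
    intro S
    have hfin : Finite (G.restrict (Subtype.val '' (S : Set G.edgeSet))).vertexSet :=
      inferInstanceAs (Finite G.vertexSet)
    have h := simple_and_isTree_iff (G.restrict (Subtype.val '' (S : Set G.edgeSet)))
      (by rw [hedge]; exact S.finite_toSet.image _)
    rw [restrict_toSimpleGraph G hst, hedge,
      Set.ncard_image_of_injective _ Subtype.val_injective, Set.ncard_coe_finset] at h
    rw [← Nat.card_eq_fintype_card, IsSpanningTree, restrict_toSimpleGraph G hst]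
    refine Iff.trans ⟨fun h => h.2, fun h => ⟨⟨restrict_le, rfl⟩, h⟩⟩ h
  ext T
  constructor
  · intro hT
    -- A spanning subgraph is determined by its edge set, so `T` is recovered by restricting `G`.
    have hT' : G.restrict (Subtype.val ''
        ((Finset.univ.filter fun e : G.edgeSet => e.1 ∈ T.edgeSet : Finset _) : Set G.edgeSet)) = T := by
      have h1 : Subtype.val '' ((Finset.univ.filter fun e : G.edgeSet => e.1 ∈ T.edgeSet :
          Finset _) : Set G.edgeSet) = T.edgeSet := by
        ext e
        simpa using fun h => hT.1.le.edgeSet_mono h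
      rw [h1]
      refine Graph.ext hT.1.vertexSet_eq.symm fun e x y => ?_
      refine ⟨fun h => (hT.1.le.isLink_iff h.1).mpr h.2, fun h => ⟨h.edge_mem, h.mono hT.1.le⟩⟩
    refine ⟨_, (hiff _).mp ?_, hT'⟩
    rw [hT']
    exact hT
  · rintro ⟨S, hS, rfl⟩
    exact (hiff S).mpr hS

/-- **Matrix-tree theorem** for multigraphs. -/
theorem det_laplacianMatrix_add_single [DecidableEq α] (G : Graph α β) [Fintype G.vertexSet]
    (hE : G.edgeSet.Finite) (r : G.vertexSet) :
    (G.laplacianMatrix + Matrix.single r r 1).det = (G.numSpanningTrees : ℤ) := by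
  classical
  have := hE.fintype
  have hex : ∀ e : G.edgeSet, ∃ x y : G.vertexSet, G.IsLink e x y := by
    rintro ⟨e, he⟩
    obtain ⟨x, y, h⟩ := exists_isLink_of_mem_edgeSet he
    exact ⟨⟨x, h.left_mem⟩, ⟨y, h.right_mem⟩, h⟩
  choose s t hst using hex
  rw [← incidence_mul_transpose_eq_laplacianMatrix G hst, numSpanningTrees_eq_ncard G hst,
    OrientedMultigraph.det_incidence_mul_transpose_add_single]

theorem laplacianMatrix_transpose [DecidableEq α] (G : Graph α β) :
    G.laplacianMatrix.transpose = G.laplacianMatrix := by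
  ext x y
  simp only [laplacianMatrix, Matrix.transpose_apply, Matrix.of_apply, G.isLink_comm (x := (x : α)),
    eq_comm (a := x)]
  split_ifs with h
  · rw [h]
  · rfl

theorem laplacianMatrix_mulVec_one [DecidableEq α] (G : Graph α β) [Fintype G.vertexSet]
    (hE : G.edgeSet.Finite) : G.laplacianMatrix.mulVec 1 = 0 := by
  classical
  have := hE.fintype
  have hex : ∀ e : G.edgeSet, ∃ x y : G.vertexSet, G.IsLink e x y := by
    rintro ⟨e, he⟩
    obtain ⟨x, y, h⟩ := exists_isLink_of_mem_edgeSet he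
    exact ⟨⟨x, h.left_mem⟩, ⟨y, h.right_mem⟩, h⟩
  choose s t hst using hex
  rw [← incidence_mul_transpose_eq_laplacianMatrix G hst, ← Matrix.mulVec_mulVec]
  have : (OrientedMultigraph.incidence s t).transpose.mulVec 1 = 0 := by
    ext e
    simp [Matrix.mulVec, dotProduct, OrientedMultigraph.incidence]
  rw [this, Matrix.mulVec_zero]

end Graph

/-! ### Determinants after adding the all-ones matrix. -/

open Matrix in
/-- If the rows and columns of `L` sum to zero, then adding the all-ones matrix to `L` has the same
effect on the determinant, up to the factor `n ^ 2`, as adding one to a diagonal entry. -/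
theorem Matrix.det_add_ones {V R : Type*} [Fintype V] [DecidableEq V] [CommRing R]
    (L : Matrix V V R) (hrow : L.mulVec 1 = 0) (hcol : Matrix.vecMul 1 L = 0) (r : V) :
    (L + Matrix.of fun _ _ => 1).det =
      (Fintype.card V : R) ^ 2 * (L + Matrix.single r r 1).det := by
  -- Chosen so that `e_r + w = 1`: multiplying by `1 + w 1ᵀ` on the left and `1 + 1 wᵀ` on the right
  -- turns `e_r e_rᵀ` into the all-ones matrix and fixes `L`. Each factor has determinant `1 + w ⬝ᵥ
  -- 1 = |V|`.
  set w : V → R := 1 - Pi.single r 1 with hw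
  have hw1 : w ⬝ᵥ 1 = (Fintype.card V : R) - 1 := by
    simp [hw, dotProduct]
  have hdet : (1 + Matrix.vecMulVec (1 : V → R) w).det = Fintype.card V := by
    rw [Matrix.vecMulVec_eq Unit, Matrix.det_one_add_replicateCol_mul_replicateRow, hw1]
    ring
  have hdet' : (1 + Matrix.vecMulVec w (1 : V → R)).det = Fintype.card V := by
    rw [Matrix.vecMulVec_eq Unit, Matrix.det_one_add_replicateCol_mul_replicateRow,
      dotProduct_comm, hw1]
    ring
  have : (1 + Matrix.vecMulVec w (1 : V → R)) * ((L + Matrix.single r r 1) *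
      (1 + Matrix.vecMulVec (1 : V → R) w)) = L + Matrix.of fun _ _ => 1 := by
    have h1 : (L + Matrix.single r r 1) * (1 + Matrix.vecMulVec (1 : V → R) w) =
        L + Matrix.vecMulVec (Pi.single r 1) 1 := by
      rw [Matrix.mul_add, Matrix.mul_one, Matrix.mul_vecMulVec, Matrix.add_mulVec, hrow,
        Matrix.single_eq_single_vecMulVec_single, add_assoc]
      congr 1
      ext i j
      simp [Matrix.vecMulVec_apply, Matrix.mulVec, dotProduct, hw, ← Finset.mul_sum]
      ring
    rw [h1, Matrix.add_mul, Matrix.one_mul, Matrix.vecMulVec_mul, Matrix.vecMul_add, hcol,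
      zero_add, add_assoc]
    congr 1
    ext i j
    simp [Matrix.vecMulVec_apply, Matrix.vecMul, dotProduct, hw]
  rw [← this, Matrix.det_mul, Matrix.det_mul, hdet, hdet']
  ring

open Matrix in
/-- Adding the all-ones matrix to `L + c`, where the rows of `L` sum to zero. -/
theorem Matrix.det_add_smul_one_add_ones {V K : Type*} [Fintype V] [DecidableEq V] [Field K]
    (L : Matrix V V K) (hrow : L.mulVec 1 = 0) {c : K} (hc : c ≠ 0) :
    (L + c • (1 : Matrix V V K) + Matrix.of fun _ _ => 1).det =
      (L + c • (1 : Matrix V V K)).det * (1 + (Fintype.card V : K) / c) := by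
  have h : L + c • (1 : Matrix V V K) + Matrix.of (fun _ _ => 1) =
      (L + c • (1 : Matrix V V K)) * (1 + Matrix.vecMulVec (c⁻¹ • (1 : V → K)) 1) := by
    rw [Matrix.mul_add, Matrix.mul_one, Matrix.mul_vecMulVec, Matrix.mulVec_smul, Matrix.add_mulVec,
      hrow, zero_add, Matrix.smul_mulVec, Matrix.one_mulVec]
    congr 1
    ext i j
    simp [Matrix.vecMulVec_apply, hc]
  rw [h, Matrix.det_mul, Matrix.vecMulVec_eq Unit, Matrix.det_one_add_replicateCol_mul_replicateRow]
  simp [dotProduct, div_eq_mul_inv]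

theorem Matrix.intCast_det_add_ones {V : Type*} [Fintype V] [DecidableEq V] (L : Matrix V V ℤ)
    (c : ℕ) :
    ((L + (c : ℤ) • (1 : Matrix V V ℤ) + Matrix.of fun _ _ => 1).det : ℝ) =
      (L.map (Int.cast : ℤ → ℝ) + (c : ℝ) • (1 : Matrix V V ℝ) + Matrix.of fun _ _ => 1).det := by
  rw [Int.cast_det]
  congr 1
  ext i j
  simp only [Matrix.map_apply, Matrix.add_apply, Matrix.smul_apply, Matrix.one_apply,
    Matrix.of_apply, smul_eq_mul]
  split_ifs <;> push_cast <;> ring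

theorem Matrix.map_intCast_mulVec_one {V : Type*} [Fintype V] {L : Matrix V V ℤ}
    (h : L.mulVec 1 = 0) : (L.map (Int.cast : ℤ → ℝ)).mulVec 1 = 0 := by
  ext i
  have := congrArg (Int.cast : ℤ → ℝ) (congrFun h i)
  simpa [Matrix.mulVec, dotProduct] using this

/-! ### The Laplacian of a join. -/

namespace Graph

variable {α₁ β₁ α₂ β₂ : Type*} (G : Graph α₁ β₁) (H : Graph α₂ β₂)

/-- The vertices of the join are those of the two graphs. -/
def joinVertexEquiv : G.vertexSet ⊕ H.vertexSet ≃ (G.join H).vertexSet where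
  toFun := Sum.elim (fun x => ⟨Sum.inl x, Or.inl ⟨x, x.2, rfl⟩⟩)
    fun x => ⟨Sum.inr x, Or.inr ⟨x, x.2, rfl⟩⟩
  invFun
    | ⟨Sum.inl x, h⟩ => Sum.inl ⟨x, by simpa [join] using h⟩
    | ⟨Sum.inr x, h⟩ => Sum.inr ⟨x, by simpa [join] using h⟩
  left_inv := by rintro (x | x) <;> rfl
  right_inv := by rintro ⟨x | x, h⟩ <;> rfl

@[simp]
theorem coe_joinVertexEquiv_inl (x : G.vertexSet) :
    (joinVertexEquiv G H (Sum.inl x) : α₁ ⊕ α₂) = Sum.inl x.1 := rfl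

@[simp]
theorem coe_joinVertexEquiv_inr (x : H.vertexSet) :
    (joinVertexEquiv G H (Sum.inr x) : α₁ ⊕ α₂) = Sum.inr x.1 := rfl

variable {G H}

theorem join_isLink_inl_inl {e : β₁ ⊕ β₂ ⊕ (α₁ × α₂)} {x y : α₁} :
    (G.join H).IsLink e (Sum.inl x) (Sum.inl y) ↔ ∃ e', e = Sum.inl e' ∧ G.IsLink e' x y := by
  constructor
  · intro h
    cases h with
    | left h => exact ⟨_, rfl, h⟩
  · rintro ⟨e', rfl, h⟩
    exact .left h

theorem join_isLink_inr_inr {e : β₁ ⊕ β₂ ⊕ (α₁ × α₂)} {x y : α₂} :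
    (G.join H).IsLink e (Sum.inr x) (Sum.inr y) ↔
      ∃ e', e = Sum.inr (Sum.inl e') ∧ H.IsLink e' x y := by
  constructor
  · intro h
    cases h with
    | right h => exact ⟨_, rfl, h⟩
  · rintro ⟨e', rfl, h⟩
    exact .right h

theorem join_isLink_inl_inr {e : β₁ ⊕ β₂ ⊕ (α₁ × α₂)} {x : α₁} {y : α₂} :
    (G.join H).IsLink e (Sum.inl x) (Sum.inr y) ↔
      e = Sum.inr (Sum.inr (x, y)) ∧ x ∈ G.vertexSet ∧ y ∈ H.vertexSet := by
  constructor
  · intro h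
    cases h with
    | cross hu hv => exact ⟨rfl, hu, hv⟩
  · rintro ⟨rfl, hu, hv⟩
    exact .cross hu hv

theorem join_isLink_inr_inl {e : β₁ ⊕ β₂ ⊕ (α₁ × α₂)} {x : α₁} {y : α₂} :
    (G.join H).IsLink e (Sum.inr y) (Sum.inl x) ↔
      e = Sum.inr (Sum.inr (x, y)) ∧ x ∈ G.vertexSet ∧ y ∈ H.vertexSet := by
  rw [isLink_comm, join_isLink_inl_inr]

theorem join_isNonloopAt_inl {x : α₁} (hx : x ∈ G.vertexSet) :
    {e | (G.join H).IsNonloopAt e (Sum.inl x)} =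
      Sum.inl '' {e | G.IsNonloopAt e x} ∪ (fun y => Sum.inr (Sum.inr (x, y))) '' H.vertexSet := by
  ext e
  simp only [IsNonloopAt, Set.mem_ofPred_eq, Sum.exists, join_isLink_inl_inl, join_isLink_inl_inr,
    Set.mem_union, Set.mem_image, ne_eq, Sum.inl.injEq, reduceCtorEq, not_false_eq_true, true_and]
  refine or_congr ?_ ?_
  · constructor
    · rintro ⟨y, hy, e', rfl, h⟩
      exact ⟨e', ⟨y, hy, h⟩, rfl⟩
    · rintro ⟨e', ⟨y, hy, h⟩, rfl⟩
      exact ⟨y, hy, e', rfl, h⟩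
  · constructor
    · rintro ⟨y, rfl, -, hy⟩
      exact ⟨y, hy, rfl⟩
    · rintro ⟨y, hy, rfl⟩
      exact ⟨y, rfl, hx, hy⟩

theorem join_isNonloopAt_inr {x : α₂} (hx : x ∈ H.vertexSet) :
    {e | (G.join H).IsNonloopAt e (Sum.inr x)} =
      (fun y => Sum.inr (Sum.inr (y, x))) '' G.vertexSet ∪
        (fun e => Sum.inr (Sum.inl e)) '' {e | H.IsNonloopAt e x} := by
  ext e
  simp only [IsNonloopAt, Set.mem_ofPred_eq, Sum.exists, join_isLink_inr_inr, join_isLink_inr_inl,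
    Set.mem_union, Set.mem_image, ne_eq, Sum.inr.injEq, reduceCtorEq, not_false_eq_true, true_and]
  refine or_congr ?_ ?_
  · constructor
    · rintro ⟨y, rfl, hy, -⟩
      exact ⟨y, hy, rfl⟩
    · rintro ⟨y, hy, rfl⟩
      exact ⟨y, rfl, hy, hx⟩
  · constructor
    · rintro ⟨y, hy, e', rfl, h⟩
      exact ⟨e', ⟨y, hy, h⟩, rfl⟩
    · rintro ⟨e', ⟨y, hy, h⟩, rfl⟩
      exact ⟨y, hy, e', rfl, h⟩

theorem join_edgeSet_finite (hV : G.vertexSet.Finite) (hV' : H.vertexSet.Finite)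
    (hE : G.edgeSet.Finite) (hE' : H.edgeSet.Finite) : (G.join H).edgeSet.Finite := by
  refine ((hE.image Sum.inl).union (((hE'.image Sum.inl).image Sum.inr).union
    (((hV.prod hV').image Sum.inr).image Sum.inr))).subset fun e he => ?_
  obtain ⟨x, y, h⟩ := exists_isLink_of_mem_edgeSet he
  cases h with
  | left h => exact Or.inl ⟨_, h.edge_mem, rfl⟩
  | right h => exact Or.inr (Or.inl ⟨_, ⟨_, h.edge_mem, rfl⟩, rfl⟩)
  | cross hu hv => exact Or.inr (Or.inr ⟨_, ⟨_, ⟨hu, hv⟩, rfl⟩, rfl⟩)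
  | cross' hu hv => exact Or.inr (Or.inr ⟨_, ⟨_, ⟨hu, hv⟩, rfl⟩, rfl⟩)

theorem laplacianMatrix_join [DecidableEq α₁] [DecidableEq α₂] [Fintype G.vertexSet]
    [Fintype H.vertexSet] (hE : G.edgeSet.Finite) (hE' : H.edgeSet.Finite) :
    (G.join H).laplacianMatrix.submatrix (joinVertexEquiv G H) (joinVertexEquiv G H) =
      Matrix.fromBlocks
        (G.laplacianMatrix + (Fintype.card H.vertexSet : ℤ) • (1 : Matrix _ _ ℤ))
        (Matrix.of fun _ _ => -1) (Matrix.of fun _ _ => -1)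
        (H.laplacianMatrix + (Fintype.card G.vertexSet : ℤ) • (1 : Matrix _ _ ℤ)) := by
  have hfin : G.vertexSet.Finite := Set.toFinite _
  have hfin' : H.vertexSet.Finite := Set.toFinite _
  have hsub : ∀ x, {e | G.IsNonloopAt e x}.Finite := fun x => hE.subset fun e he => he.edge_mem
  have hsub' : ∀ x, {e | H.IsNonloopAt e x}.Finite := fun x => hE'.subset fun e he => he.edge_mem
  have hcard : Fintype.card G.vertexSet = G.vertexSet.ncard := by
    rw [← Nat.card_eq_fintype_card]; rfl
  have hcard' : Fintype.card H.vertexSet = H.vertexSet.ncard := by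
    rw [← Nat.card_eq_fintype_card]; rfl
  ext (x | x) (y | y)
  · simp only [laplacianMatrix, Matrix.submatrix_apply, Matrix.of_apply, coe_joinVertexEquiv_inl,
      Matrix.fromBlocks_apply₁₁, Matrix.add_apply, Matrix.smul_apply, Matrix.one_apply,
      EmbeddingLike.apply_eq_iff_eq, Sum.inl.injEq]
    split_ifs with h
    · rw [join_isNonloopAt_inl x.2, Set.ncard_union_eq ?_ ((hsub x).image _) (hfin'.image _),
        Set.ncard_image_of_injective _ Sum.inl_injective, Set.ncard_image_of_injective, hcard']
      · simp
      · intro a b hab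
        simpa using hab
      · rw [Set.disjoint_left]
        rintro _ ⟨e, -, rfl⟩ ⟨y, -, h⟩
        simp at h
    · have : {e | (G.join H).IsLink e (Sum.inl x.1) (Sum.inl y.1)} =
          Sum.inl '' {e | G.IsLink e x y} := by
        ext e
        rw [Set.mem_ofPred_eq, join_isLink_inl_inl]
        exact ⟨fun ⟨e', h, h'⟩ => ⟨e', h', h.symm⟩, fun ⟨e', h, h'⟩ => ⟨e', h'.symm, h⟩⟩
      rw [this, Set.ncard_image_of_injective _ Sum.inl_injective]
      simp
  · have : {e | (G.join H).IsLink e (Sum.inl x.1) (Sum.inr y.1)} =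
        {Sum.inr (Sum.inr (x.1, y.1))} := by
      ext e
      simp [join_isLink_inl_inr]
    simp [laplacianMatrix, this]
  · have : {e | (G.join H).IsLink e (Sum.inr x.1) (Sum.inl y.1)} =
        {Sum.inr (Sum.inr (y.1, x.1))} := by
      ext e
      simp [join_isLink_inr_inl]
    simp [laplacianMatrix, this]
  · simp only [laplacianMatrix, Matrix.submatrix_apply, Matrix.of_apply, coe_joinVertexEquiv_inr,
      Matrix.fromBlocks_apply₂₂, Matrix.add_apply, Matrix.smul_apply, Matrix.one_apply,
      EmbeddingLike.apply_eq_iff_eq, Sum.inr.injEq]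
    split_ifs with h
    · rw [join_isNonloopAt_inr x.2, Set.ncard_union_eq ?_ (hfin.image _) ((hsub' x).image _),
        Set.ncard_image_of_injective, Set.ncard_image_of_injective, hcard]
      · simp [add_comm]
      · intro a b hab
        simpa using hab
      · intro a b hab
        simpa using hab
      · rw [Set.disjoint_left]
        rintro _ ⟨e, -, rfl⟩ ⟨y, -, h⟩
        simp at h
    · have : {e | (G.join H).IsLink e (Sum.inr x.1) (Sum.inr y.1)} =
          (fun e => Sum.inr (Sum.inl e)) '' {e | H.IsLink e x y} := by
        ext e
        rw [Set.mem_ofPred_eq, join_isLink_inr_inr]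
        exact ⟨fun ⟨e', h, h'⟩ => ⟨e', h', h.symm⟩, fun ⟨e', h, h'⟩ => ⟨e', h'.symm, h⟩⟩
      rw [this, Set.ncard_image_of_injective]
      · simp
      · intro a b hab
        simpa using hab

/-- Adding the all-ones matrix makes the Laplacian of the join block diagonal, so the two graphs
separate. -/
theorem numSpanningTrees_join [DecidableEq α₁] [DecidableEq α₂] [Fintype G.vertexSet]
    [Fintype H.vertexSet] [Nonempty G.vertexSet] [Nonempty H.vertexSet]
    (hE : G.edgeSet.Finite) (hE' : H.edgeSet.Finite) :
    (Fintype.card G.vertexSet : ℝ) * Fintype.card H.vertexSet * (G.join H).numSpanningTrees =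
      (G.laplacianMatrix.map (Int.cast : ℤ → ℝ) +
        (Fintype.card H.vertexSet : ℝ) • (1 : Matrix _ _ ℝ)).det *
      (H.laplacianMatrix.map (Int.cast : ℤ → ℝ) +
        (Fintype.card G.vertexSet : ℝ) • (1 : Matrix _ _ ℝ)).det := by
  have hm : (Fintype.card G.vertexSet : ℝ) ≠ 0 := Nat.cast_ne_zero.mpr Fintype.card_ne_zero
  have hn : (Fintype.card H.vertexSet : ℝ) ≠ 0 := Nat.cast_ne_zero.mpr Fintype.card_ne_zero
  let := Fintype.ofEquiv _ (joinVertexEquiv G H)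
  have hEj : (G.join H).edgeSet.Finite :=
    join_edgeSet_finite (Set.toFinite _) (Set.toFinite _) hE hE'
  have hrow := laplacianMatrix_mulVec_one (G.join H) hEj
  have hcol : Matrix.vecMul 1 (G.join H).laplacianMatrix = 0 := by
    rw [← Matrix.mulVec_transpose, laplacianMatrix_transpose, hrow]
  have h1 := Matrix.det_add_ones _ hrow hcol (joinVertexEquiv G H (Sum.inl (Classical.arbitrary _)))
  rw [det_laplacianMatrix_add_single _ hEj, ← Matrix.det_submatrix_equiv_self (joinVertexEquiv G H),
    Fintype.card_congr (joinVertexEquiv G H).symm, Fintype.card_sum] at h1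
  have h2 : ((G.join H).laplacianMatrix + Matrix.of fun _ _ => 1).submatrix
      (joinVertexEquiv G H) (joinVertexEquiv G H) = Matrix.fromBlocks
        (G.laplacianMatrix + (Fintype.card H.vertexSet : ℤ) • (1 : Matrix _ _ ℤ) +
          Matrix.of fun _ _ => 1) 0 0
        (H.laplacianMatrix + (Fintype.card G.vertexSet : ℤ) • (1 : Matrix _ _ ℤ) +
          Matrix.of fun _ _ => 1) := by
    rw [Matrix.submatrix_add, Pi.add_apply, Pi.add_apply, laplacianMatrix_join hE hE']
    ext (x | x) (y | y) <;> simp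
  rw [h2, Matrix.det_fromBlocks_zero₂₁] at h1
  have h3 := congrArg (Int.cast : ℤ → ℝ) h1
  rw [Int.cast_mul, Matrix.intCast_det_add_ones, Matrix.intCast_det_add_ones,
    Matrix.det_add_smul_one_add_ones _ (Matrix.map_intCast_mulVec_one (laplacianMatrix_mulVec_one G hE)) hn,
    Matrix.det_add_smul_one_add_ones _ (Matrix.map_intCast_mulVec_one (laplacianMatrix_mulVec_one H hE')) hm] at h3
  push_cast at h3
  -- With orders `m` and `n`, the correction factors multiply to `(1 + m/n)(1 + n/m) = (m +
  -- n)²/(mn)`, against `(m + n)²` on the side of the tree count.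
  have hmn : (Fintype.card G.vertexSet : ℝ) + Fintype.card H.vertexSet ≠ 0 := by positivity
  field_simp at h3
  apply mul_left_cancel₀ hmn
  linear_combination -h3

end Graph

/-! ### Spectra of bipartite matrices. -/

/-- The product of a function with two values, `a` on `p` and `b` off `p`. -/
theorem Finset.prod_univ_ite_const {V R : Type*} [Fintype V] [CommMonoid R] (p : V → Prop)
    [DecidablePred p] (a b : R) :
    ∏ x : V, (if p x then a else b) = a ^ Fintype.card {x // p x} * b ^ Fintype.card {x // ¬ p x} := by
  rw [Finset.prod_ite, Finset.prod_const, Finset.prod_const, Fintype.card_subtype,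
    Fintype.card_subtype]

namespace Matrix

open Polynomial

variable {V : Type*} [Fintype V] {A : Matrix V V ℝ} {p : V → Prop} [DecidablePred p]

/-- The weighted vector with entries `√a` on `p` and `√b` off `p` is a Perron eigenvector of a
bipartite matrix with row sums `a` on `p` and `b` off `p`. -/
theorem mulVec_sqrt_of_bipartite (hA : ∀ x y, A x y ≠ 0 → (p x ↔ ¬ p y)) {a b : ℝ} (ha : 0 ≤ a)
    (hb : 0 ≤ b) (hsum : ∀ x, ∑ y, A x y = if p x then a else b) :
    A *ᵥ (fun x => if p x then √a else √b) = √(a * b) • fun x => if p x then √a else √b := by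
  ext x
  -- A nonzero entry joins opposite parts, so the weight at `y` depends only on the part of `x` and
  -- leaves the row sum.
  have h : ∀ y, A x y * (if p y then √a else √b) = A x y * (if p x then √b else √a) := by
    intro y
    by_cases hz : A x y = 0
    · simp [hz]
    · have := hA x y hz
      by_cases hp : p y
      · have hx : ¬ p x := by tauto
        simp [hp, hx]
      · have hx : p x := by tauto
        simp [hp, hx]
  simp only [mulVec, dotProduct, Pi.smul_apply, smul_eq_mul]
  rw [Finset.sum_congr rfl fun y _ => h y, ← Finset.sum_mul, hsum, Real.sqrt_mul ha]
  split_ifs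
  · linear_combination -√b * Real.mul_self_sqrt ha
  · linear_combination -√a * Real.mul_self_sqrt hb

variable [DecidableEq V]

/-- Scale rows and columns of `t - A` by `√(a/t)` on `p` and `√(b/t)` off it. Entries of `A` link
opposite parts, so they are multiplied by `√(ab)/t = 1`, while the diagonal becomes `a` or `b`. -/
theorem det_diagonal_sub_of_bipartite (hA : ∀ x y, A x y ≠ 0 → (p x ↔ ¬ p y)) {a b t : ℝ}
    (ha : 0 < a) (hb : 0 < b) (ht : 0 < t) (htab : t ^ 2 = a * b) :
    (diagonal (fun x => if p x then a else b) - A).det =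
      (a / t) ^ Fintype.card {x // p x} * (b / t) ^ Fintype.card {x // ¬ p x} *
        A.charpoly.eval t := by
  set S : Matrix V V ℝ := diagonal fun x => if p x then √(a / t) else √(b / t) with hS
  have h1 : √(a / t) * √(a / t) = a / t := Real.mul_self_sqrt (by positivity)
  have h2 : √(b / t) * √(b / t) = b / t := Real.mul_self_sqrt (by positivity)
  have h3 : √(a / t) * √(b / t) = 1 := by
    rw [← Real.sqrt_mul (by positivity), div_mul_div_comm, ← htab, sq, div_self (by positivity),
      Real.sqrt_one]
  have key : diagonal (fun x => if p x then a else b) - A = S * (scalar V t - A) * S := by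
    ext x y
    rw [hS, mul_diagonal, diagonal_mul]
    simp only [sub_apply, diagonal_apply, scalar_apply]
    have hxy := hA x y
    by_cases hz : A x y = 0
    · rw [hz]
      by_cases h : x = y
      · subst h
        by_cases hp : p x <;> simp only [hp, if_true, if_false, sub_zero]
        · rw [mul_right_comm, h1]
          field_simp
        · rw [mul_right_comm, h2]
          field_simp
      · simp [h]
    · have hne : x ≠ y := by
        rintro rfl
        have := hxy hz
        tauto
      have := hxy hz
      by_cases hp : p y
      · have hx : ¬ p x := by tauto
        simp only [hne, hp, hx, if_true, if_false]
        linear_combination (A x y) * h3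
      · have hx : p x := by tauto
        simp only [hne, hp, hx, if_true, if_false]
        linear_combination (A x y) * h3
  rw [key, det_mul, det_mul, eval_charpoly, hS, det_diagonal, Finset.prod_univ_ite_const]
  conv_rhs => rw [← h1, ← h2]
  ring

/-- Conjugation by the diagonal matrix of signs, `1` on `p` and `-1` off it, sends `A` to `-A`. -/
theorem roots_charpoly_map_neg_of_bipartite (hA : ∀ x y, A x y ≠ 0 → (p x ↔ ¬ p y)) :
    A.charpoly.roots.map (fun r => -r) = A.charpoly.roots := by
  set S : Matrix V V ℝ := diagonal fun x => if p x then 1 else -1 with hS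
  have hS2 : S.det * S.det = 1 := by
    rw [← det_mul, hS, diagonal_mul_diagonal, ← det_one (n := V)]
    congr 1
    rw [← diagonal_one]
    congr 1
    ext x
    split_ifs <;> simp
  have key : ∀ t : ℝ, scalar V (-t) - A = -(S * (scalar V t - A) * S) := by
    intro t
    ext x y
    rw [neg_apply, hS, mul_diagonal, diagonal_mul]
    simp only [sub_apply, diagonal_apply, scalar_apply]
    have hxy := hA x y
    by_cases hz : A x y = 0
    · rw [hz]
      by_cases h : x = y
      · subst h
        by_cases hp : p x <;> simp [hp]
      · simp [h]
    · have hne : x ≠ y := by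
        rintro rfl
        have := hxy hz
        tauto
      have := hxy hz
      by_cases hp : p y
      · have hx : ¬ p x := by tauto
        simp [hne, hp, hx]
      · have hx : p x := by tauto
        simp [hne, hp, hx]
  have hpoly : A.charpoly.comp (-X) = C ((-1) ^ Fintype.card V) * A.charpoly := by
    apply Polynomial.funext
    intro t
    rw [eval_comp, eval_neg, eval_X, eval_mul, eval_C, eval_charpoly, eval_charpoly, key, det_neg,
      det_mul, det_mul]
    linear_combination (-1) ^ Fintype.card V * (scalar V t - A).det * hS2
  rw [← roots_comp_neg_X, hpoly, roots_C_mul _ (by simp)]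

theorem roots_charpoly_eq_of_bipartite (hA : ∀ x y, A x y ≠ 0 → (p x ↔ ¬ p y)) :
    A.charpoly.roots = A.charpoly.roots.filter (0 < ·) +
      (A.charpoly.roots.filter (0 < ·)).map (fun r => -r) +
      Multiset.replicate (A.charpoly.roots.count 0) 0 := by
  have h1 : (A.charpoly.roots.filter (0 < ·)).map (fun r => -r) =
      A.charpoly.roots.filter (· < 0) := by
    conv_rhs => rw [← roots_charpoly_map_neg_of_bipartite hA, Multiset.filter_map]
    simp
  rw [h1]
  ext r
  rw [Multiset.count_add, Multiset.count_add, Multiset.count_filter, Multiset.count_filter,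
    Multiset.count_replicate]
  rcases lt_trichotomy 0 r with h | h | h
  · simp [h, h.not_gt, h.ne]
  · simp [← h]
  · simp [h, h.not_gt, h.ne']

/-- Pair each positive root `r` with `-r`; the zero roots give the remaining power of `t`. The
factor on the left avoids a subtraction in the exponent. -/
theorem eval_charpoly_of_bipartite (hsymm : A.IsHermitian)
    (hA : ∀ x y, A x y ≠ 0 → (p x ↔ ¬ p y)) (t : ℝ) :
    A.charpoly.eval t * t ^ (2 * (A.charpoly.roots.filter (0 < ·)).card) =
      t ^ Fintype.card V *
        ((A.charpoly.roots.filter (0 < ·)).map fun r => t ^ 2 - r ^ 2).prod := by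
  have h := roots_charpoly_eq_of_bipartite hA
  have hcard : A.charpoly.roots.card = Fintype.card V := by
    rw [splits_iff_card_roots.mp hsymm.splits_charpoly, charpoly_natDegree_eq_dim]
  rw [hsymm.splits_charpoly.eval_eq_prod_roots_of_monic (charpoly_monic A), ← hcard]
  generalize A.charpoly.roots.count 0 = m at h
  generalize A.charpoly.roots.filter (0 < ·) = P at h ⊢
  rw [h]
  have h2 : (P.map fun r => t ^ 2 - r ^ 2).prod =
      (P.map fun r => t - r).prod * (P.map fun r => t + r).prod := by
    rw [← Multiset.prod_map_mul]
    congr 2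
    ext r
    ring
  rw [h2]
  simp only [Multiset.map_add, Multiset.prod_add, Multiset.map_map, Multiset.map_replicate,
    Multiset.prod_replicate, Multiset.card_add, Multiset.card_map, Multiset.card_replicate,
    Function.comp_def, sub_neg_eq_add, sub_zero]
  ring

theorem rank_add_le {m n K : Type*} [Fintype m] [Fintype n] [Field K] (B C : Matrix m n K) :
    (B + C).rank ≤ B.rank + C.rank := by
  rw [rank, rank, rank, mulVecLin_add]
  refine le_trans (Submodule.finrank_mono ?_) (Submodule.finrank_add_le_finrank_add_finrank _ _)
  rintro _ ⟨v, rfl⟩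
  exact Submodule.add_mem_sup ⟨v, rfl⟩ ⟨v, rfl⟩

/-- By symmetry of the spectrum and diagonalizability, twice the number of positive roots is the
rank. With `D` the projection onto `p`, bipartiteness gives `A = D A + A D`, so the rank is at most
`2 rank D`. -/
theorem card_pos_roots_charpoly_le (hsymm : A.IsHermitian)
    (hA : ∀ x y, A x y ≠ 0 → (p x ↔ ¬ p y)) :
    (A.charpoly.roots.filter (0 < ·)).card ≤ Fintype.card {x // p x} := by
  have h := congrArg Multiset.card (roots_charpoly_eq_of_bipartite hA)
  have hzero : A.charpoly.roots.count 0 + A.rank = Fintype.card V := by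
    rw [hsymm.rank_eq_card_non_zero_eigs, hsymm.roots_charpoly_eq_eigenvalues, Multiset.count_map,
      Fintype.card_subtype, ← Finset.card_univ,
      ← Finset.card_filter_add_card_filter_not (s := Finset.univ) fun i => 0 = hsymm.eigenvalues i]
    simp only [eq_comm (a := (0 : ℝ))]
    rfl
  have hrank : A.rank ≤ 2 * Fintype.card {x // p x} := by
    set D : Matrix V V ℝ := diagonal fun x => if p x then 1 else 0 with hD
    have hADA : A = D * A + A * D := by
      ext x y
      rw [add_apply, hD, diagonal_mul, mul_diagonal]
      by_cases hz : A x y = 0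
      · simp [hz]
      · have := hA x y hz
        by_cases hp : p y
        · have hx : ¬ p x := by tauto
          simp [hp, hx]
        · have hx : p x := by tauto
          simp [hp, hx]
    have hDrank : D.rank = Fintype.card {x // p x} := by
      rw [hD, rank_diagonal]
      exact Fintype.card_congr (Equiv.subtypeEquivRight fun x => by simp)
    calc A.rank = (D * A + A * D).rank := congrArg rank hADA
      _ ≤ (D * A).rank + (A * D).rank := rank_add_le _ _
      _ ≤ D.rank + D.rank := add_le_add (rank_mul_le_left _ _) (rank_mul_le_right _ _)
      _ = _ := by rw [hDrank, two_mul]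
  rw [splits_iff_card_roots.mp hsymm.splits_charpoly, charpoly_natDegree_eq_dim] at h
  simp only [Multiset.card_add, Multiset.card_map, Multiset.card_replicate] at h
  omega

theorem card_pos_roots_charpoly_le_compl (hsymm : A.IsHermitian)
    (hA : ∀ x y, A x y ≠ 0 → (p x ↔ ¬ p y)) :
    (A.charpoly.roots.filter (0 < ·)).card ≤ Fintype.card {x // ¬ p x} :=
  card_pos_roots_charpoly_le hsymm fun x y h => not_congr (hA x y h)

theorem det_diagonal_sub_eq_of_bipartite (hsymm : A.IsHermitian)
    (hA : ∀ x y, A x y ≠ 0 → (p x ↔ ¬ p y)) {a b : ℝ} (ha : 0 < a) (hb : 0 < b) :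
    (diagonal (fun x => if p x then a else b) - A).det =
      a ^ (Fintype.card {x // p x} - (A.charpoly.roots.filter (0 < ·)).card) *
      b ^ (Fintype.card {x // ¬ p x} - (A.charpoly.roots.filter (0 < ·)).card) *
      ((A.charpoly.roots.filter (0 < ·)).map fun r => a * b - r ^ 2).prod := by
  -- The part sizes become `k + i` and `k + j`, with `k` the number of positive roots, so the
  -- truncated subtractions are exact.
  obtain ⟨i, hi⟩ := Nat.exists_eq_add_of_le (card_pos_roots_charpoly_le hsymm hA)
  obtain ⟨j, hj⟩ := Nat.exists_eq_add_of_le (card_pos_roots_charpoly_le_compl hsymm hA)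
  have ht : 0 < √(a * b) := by positivity
  have htab : √(a * b) ^ 2 = a * b := Real.sq_sqrt (by positivity)
  have heval := eval_charpoly_of_bipartite hsymm hA √(a * b)
  rw [det_diagonal_sub_of_bipartite hA ha hb ht htab]
  rw [← Fintype.card_congr (Equiv.sumCompl p), Fintype.card_sum, pow_mul] at heval
  rw [htab] at heval
  rw [hi, hj] at heval ⊢
  simp only [Nat.add_sub_cancel_left]
  generalize (A.charpoly.roots.filter (0 < ·)).card = k at *
  generalize √(a * b) = t at *
  apply mul_right_cancel₀ (pow_ne_zero k (mul_pos ha hb).ne')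
  rw [mul_assoc, heval, div_pow, div_pow, mul_pow, pow_add, pow_add, pow_add, pow_add, pow_add]
  field_simp
  ring

/-- The Perron argument: evaluate the eigenvector equation at an index maximizing `|v x| / w x`, and
bound every other `|v y|` by that ratio times `w y`. -/
theorem abs_le_of_isRoot_charpoly {w : V → ℝ} {c r : ℝ} (hnonneg : ∀ x y, 0 ≤ A x y)
    (hw : ∀ x, 0 < w x) (hAw : A *ᵥ w = c • w) (hr : A.charpoly.IsRoot r) : |r| ≤ c := by
  rw [IsRoot.def, eval_charpoly, ← exists_mulVec_eq_zero_iff] at hr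
  obtain ⟨v, hv, hrv⟩ := hr
  have hAv : ∀ x, ∑ y, A x y * v y = r * v x := by
    intro x
    have := congrFun hrv x
    rw [sub_mulVec, Pi.sub_apply, Pi.zero_apply, sub_eq_zero] at this
    simpa [mulVec, dotProduct, scalar_apply, diagonal_apply] using this.symm
  have hne : (Finset.univ : Finset V).Nonempty := by
    obtain ⟨x, -⟩ := Function.ne_iff.mp hv
    exact ⟨x, Finset.mem_univ x⟩
  obtain ⟨x, -, hx⟩ := Finset.exists_max_image Finset.univ (fun x => |v x| / w x) hne
  have hle : ∀ y, |v y| ≤ |v x| / w x * w y := fun y =>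
    (div_le_iff₀ (hw y)).mp (hx y (Finset.mem_univ y))
  have hpos : 0 < |v x| := by
    obtain ⟨y, hy⟩ := Function.ne_iff.mp hv
    have h1 := (abs_pos.mpr hy).trans_le (hle y)
    have h2 := pos_of_mul_pos_left h1 (hw y).le
    exact (div_pos_iff_of_pos_right (hw x)).mp h2
  have hAwx : ∑ y, A x y * w y = c * w x := by
    simpa [mulVec, dotProduct] using congrFun hAw x
  have : |r| * |v x| ≤ c * |v x| := by
    calc |r| * |v x| = |∑ y, A x y * v y| := by rw [hAv, abs_mul]
      _ ≤ ∑ y, |A x y * v y| := Finset.abs_sum_le_sum_abs _ _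
      _ ≤ ∑ y, |v x| / w x * (A x y * w y) := by
        refine Finset.sum_le_sum fun y _ => ?_
        rw [abs_mul, abs_of_nonneg (hnonneg x y), mul_left_comm]
        exact mul_le_mul_of_nonneg_left (hle y) (hnonneg x y)
      _ = c * |v x| := by
        rw [← Finset.mul_sum, hAwx]
        have := (hw x).ne'
        field_simp
  exact le_of_mul_le_mul_right this hpos

theorem isRoot_charpoly_of_mulVec {w : V → ℝ} {c : ℝ} (hw : w ≠ 0) (hAw : A *ᵥ w = c • w) :
    A.charpoly.IsRoot c := by
  rw [IsRoot.def, eval_charpoly, ← exists_mulVec_eq_zero_iff]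
  refine ⟨w, hw, ?_⟩
  rw [sub_mulVec, hAw, sub_eq_zero]
  ext x
  simp [mulVec, dotProduct, scalar_apply, diagonal_apply]

end Matrix

/-! ### Semiregular bipartite graphs. -/

namespace Graph.IsSemiregularBipartite

variable {α β : Type*} {G : Graph α β} {A B : Set α} {p q : ℕ}

theorem not_isLoopAt (h : G.IsSemiregularBipartite A B p q) (e : β) (x : α) : ¬ G.IsLoopAt e x := by
  intro he
  rcases h.bipartite e x x he with ⟨h1, h2⟩ | ⟨h1, h2⟩
  · exact Set.disjoint_left.mp h.disjoint h1 h2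
  · exact Set.disjoint_left.mp h.disjoint h2 h1

theorem mem_right_iff (h : G.IsSemiregularBipartite A B p q) (x : G.vertexSet) :
    x.1 ∈ B ↔ x.1 ∉ A := by
  have hx : x.1 ∈ A ∪ B := h.union_eq.ge x.2
  exact ⟨fun h1 h2 => Set.disjoint_left.mp h.disjoint h2 h1, hx.resolve_left⟩

theorem degree_eq (h : G.IsSemiregularBipartite A B p q) (x : α) :
    G.degree x = {e | G.IsNonloopAt e x}.ncard := by
  simp [degree, h.not_isLoopAt]

/-- An edge at a vertex of `A` ends in `B`. So positivity need only be assumed for one degree of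
each graph. -/
theorem right_pos (h : G.IsSemiregularBipartite A B p q) (hE : G.edgeSet.Finite) (hp : 0 < p) :
    0 < q := by
  obtain ⟨x, hx⟩ := h.nonempty_left
  rw [← h.degree_left x hx, h.degree_eq] at hp
  obtain ⟨e, y, -, he⟩ := Set.nonempty_of_ncard_ne_zero hp.ne'
  have hy : y ∈ B := by
    rcases h.bipartite e x y he with ⟨-, h2⟩ | ⟨h1, -⟩
    · exact h2
    · exact absurd h1 (Set.disjoint_left.mp h.disjoint hx)
  rw [← h.degree_right y hy, h.degree_eq, Set.ncard_pos (hE.subset fun e he => he.edge_mem)]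
  exact ⟨e, x, fun hxy => Set.disjoint_left.mp h.disjoint hx (hxy ▸ hy), he.symm⟩

open Classical in
theorem card_left [Fintype G.vertexSet] (h : G.IsSemiregularBipartite A B p q) :
    Fintype.card {x : G.vertexSet // x.1 ∈ A} = A.ncard := by
  rw [← Nat.card_eq_fintype_card]
  refine Nat.card_congr
    ⟨fun x => ⟨x.1, x.2⟩, fun x => ⟨⟨x.1, h.union_eq ▸ Or.inl x.2⟩, x.2⟩, fun _ => rfl, fun _ => rfl⟩

open Classical in
theorem card_right [Fintype G.vertexSet] (h : G.IsSemiregularBipartite A B p q) :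
    Fintype.card {x : G.vertexSet // ¬ x.1 ∈ A} = B.ncard := by
  rw [← Nat.card_eq_fintype_card]
  refine Nat.card_congr
    ⟨fun x => ⟨x.1, (h.mem_right_iff _).mpr x.2⟩,
      fun x => ⟨⟨x.1, h.union_eq ▸ Or.inr x.2⟩, (h.mem_right_iff ⟨x.1, _⟩).mp x.2⟩,
      fun _ => rfl, fun _ => rfl⟩

theorem card_vertexSet [Fintype G.vertexSet] (h : G.IsSemiregularBipartite A B p q) :
    Fintype.card G.vertexSet = A.ncard + B.ncard := by
  classical
  rw [← Fintype.card_congr (Equiv.sumCompl fun x : G.vertexSet => x.1 ∈ A), Fintype.card_sum,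
    h.card_left, h.card_right]

variable [DecidableEq α]

theorem adjacencyMatrix_nonneg (x y : G.vertexSet) : 0 ≤ G.adjacencyMatrix x y := by
  simp only [adjacencyMatrix, Matrix.of_apply]
  split_ifs <;> positivity

theorem adjacencyMatrix_bipartite (h : G.IsSemiregularBipartite A B p q) (x y : G.vertexSet)
    (hxy : G.adjacencyMatrix x y ≠ 0) : x.1 ∈ A ↔ ¬ y.1 ∈ A := by
  simp only [adjacencyMatrix, Matrix.of_apply, h.not_isLoopAt] at hxy
  split_ifs at hxy with h1
  · simp at hxy
  · obtain ⟨e, he⟩ := Set.nonempty_of_ncard_ne_zero (Nat.cast_ne_zero.mp hxy)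
    rcases h.bipartite e x y he with ⟨hx, hy⟩ | ⟨hx, hy⟩
    · simp [hx, (h.mem_right_iff y).mp hy]
    · simp [hy, (h.mem_right_iff x).mp hx]

theorem adjacencyMatrix_isHermitian : G.adjacencyMatrix.IsHermitian := by
  ext x y
  simp only [adjacencyMatrix, Matrix.conjTranspose_apply, Matrix.of_apply, star_trivial,
    G.isLink_comm (x := (x : α)), eq_comm (a := x)]
  split_ifs with h
  · rw [h]
  · rfl

open Classical in
theorem laplacianMatrix_eq (h : G.IsSemiregularBipartite A B p q) :
    G.laplacianMatrix.map (Int.cast : ℤ → ℝ) =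
      Matrix.diagonal (fun x : G.vertexSet => if x.1 ∈ A then (p : ℝ) else q) -
        G.adjacencyMatrix := by
  ext x y
  simp only [laplacianMatrix, adjacencyMatrix, Matrix.map_apply, Matrix.of_apply, Matrix.sub_apply,
    Matrix.diagonal_apply, h.not_isLoopAt]
  split_ifs with h1 h2
  · simp [← h.degree_eq, h.degree_left x h2]
  · simp [← h.degree_eq, h.degree_right x ((h.mem_right_iff x).mpr h2)]
  · simp

variable [Fintype G.vertexSet]

open Classical in
theorem sum_adjacencyMatrix (h : G.IsSemiregularBipartite A B p q) (hE : G.edgeSet.Finite)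
    (x : G.vertexSet) : ∑ y, G.adjacencyMatrix x y = if x.1 ∈ A then (p : ℝ) else q := by
  have h1 := congrFun (Matrix.map_intCast_mulVec_one (laplacianMatrix_mulVec_one G hE)) x
  rw [h.laplacianMatrix_eq, Matrix.sub_mulVec, Pi.sub_apply, Matrix.mulVec_diagonal] at h1
  simp only [Pi.one_apply, mul_one, Pi.zero_apply, sub_eq_zero] at h1
  rw [h1]
  simp [Matrix.mulVec, dotProduct]

theorem card_filter_pos_roots {k : ℕ} {lam : ℕ → ℝ} (hlam : G.HasPositiveEigenvalues k lam) :
    (G.adjacencyMatrix.charpoly.roots.filter (0 < ·)).card = k := by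
  rw [hlam.2]
  simp

theorem numPositiveEigenvalues_le (h : G.IsSemiregularBipartite A B p q) {k : ℕ} {lam : ℕ → ℝ}
    (hlam : G.HasPositiveEigenvalues k lam) : k ≤ A.ncard ∧ k ≤ B.ncard := by
  classical
  rw [← h.card_left, ← h.card_right, ← card_filter_pos_roots hlam]
  exact ⟨Matrix.card_pos_roots_charpoly_le adjacencyMatrix_isHermitian h.adjacencyMatrix_bipartite,
    Matrix.card_pos_roots_charpoly_le_compl adjacencyMatrix_isHermitian h.adjacencyMatrix_bipartite⟩

/-- The vector with entries `√p` on `A` and `√q` on `B` is a positive eigenvector for `√(pq)`. This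
value is thus a positive root, and by the Perron bound the largest one. -/
theorem one_le_and_largest_eigenvalue (h : G.IsSemiregularBipartite A B p q)
    (hE : G.edgeSet.Finite) (hp : 0 < p) {k : ℕ} {lam : ℕ → ℝ}
    (hlam : G.HasPositiveEigenvalues k lam) : 1 ≤ k ∧ lam 1 = √((p : ℝ) * q) := by
  classical
  have hq := h.right_pos hE hp
  have hp' : (0 : ℝ) < p := Nat.cast_pos.mpr hp
  have hq' : (0 : ℝ) < q := Nat.cast_pos.mpr hq
  set w : G.vertexSet → ℝ := fun x => if x.1 ∈ A then √(p : ℝ) else √(q : ℝ) with hw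
  have hwpos : ∀ x, 0 < w x := by
    intro x
    simp only [hw]
    split_ifs <;> positivity
  have hAw : G.adjacencyMatrix.mulVec w = √((p : ℝ) * q) • w :=
    Matrix.mulVec_sqrt_of_bipartite h.adjacencyMatrix_bipartite hp'.le hq'.le
      (h.sum_adjacencyMatrix hE)
  have hne : G.adjacencyMatrix.charpoly ≠ 0 := (Matrix.charpoly_monic _).ne_zero
  have hmem : ∀ r, (∃ i ∈ Finset.Icc 1 k, lam i = r) ↔
      G.adjacencyMatrix.charpoly.IsRoot r ∧ 0 < r := by
    intro r
    have h1 : r ∈ (Finset.Icc 1 k).val.map lam ↔ r ∈ G.adjacencyMatrix.charpoly.roots.filter (0 < ·) :=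
      by rw [hlam.2]
    rwa [Multiset.mem_map, Multiset.mem_filter, Polynomial.mem_roots hne] at h1
  have hw0 : w ≠ 0 := by
    obtain ⟨x, hx⟩ := h.nonempty_left
    exact fun h0 => (hwpos ⟨x, h.union_eq ▸ Or.inl hx⟩).ne' (congrFun h0 _)
  obtain ⟨i, hi, hir⟩ := (hmem √((p : ℝ) * q)).mpr
    ⟨Matrix.isRoot_charpoly_of_mulVec hw0 hAw, by positivity⟩
  rw [Finset.mem_Icc] at hi
  have hk : 1 ≤ k := hi.1.trans hi.2
  refine ⟨hk, le_antisymm ?_ ?_⟩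
  · obtain ⟨hroot, -⟩ := (hmem (lam 1)).mp ⟨1, Finset.mem_Icc.mpr ⟨le_rfl, hk⟩, rfl⟩
    exact (le_abs_self _).trans
      (Matrix.abs_le_of_isRoot_charpoly adjacencyMatrix_nonneg hwpos hAw hroot)
  · rw [← hir]
    exact hlam.1 ⟨le_rfl, hk⟩ hi hi.1

/-- The factor of the largest eigenvalue, `(p + c)(q + c) - pq = c (p + q + c)`, is split off; hence
the product starts at 2. -/
theorem det_laplacianMatrix_add_smul_one (h : G.IsSemiregularBipartite A B p q)
    (hE : G.edgeSet.Finite) (hp : 0 < p) {k : ℕ} {lam : ℕ → ℝ}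
    (hlam : G.HasPositiveEigenvalues k lam) {c : ℝ} (hc : 0 < c) :
    (G.laplacianMatrix.map (Int.cast : ℤ → ℝ) + c • (1 : Matrix _ _ ℝ)).det =
      c * ((p + q + c) * ((p + c) ^ (A.ncard - k) * (q + c) ^ (B.ncard - k) *
        ∏ i ∈ Finset.Icc 2 k, ((p + c) * (q + c) - lam i ^ 2))) := by
  classical
  obtain ⟨hk, h1⟩ := h.one_le_and_largest_eigenvalue hE hp hlam
  have hmat : G.laplacianMatrix.map (Int.cast : ℤ → ℝ) + c • (1 : Matrix _ _ ℝ) =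
      Matrix.diagonal (fun x : G.vertexSet => if x.1 ∈ A then (p : ℝ) + c else q + c) -
        G.adjacencyMatrix := by
    rw [h.laplacianMatrix_eq]
    ext x y
    simp only [Matrix.add_apply, Matrix.sub_apply, Matrix.diagonal_apply, Matrix.smul_apply,
      Matrix.one_apply, smul_eq_mul]
    split_ifs <;> ring
  rw [hmat, Matrix.det_diagonal_sub_eq_of_bipartite adjacencyMatrix_isHermitian
    h.adjacencyMatrix_bipartite (by positivity) (by positivity), card_filter_pos_roots hlam,
    h.card_left, h.card_right, hlam.2, Multiset.map_map]
  change _ * (∏ i ∈ Finset.Icc 1 k, (((p : ℝ) + c) * (q + c) - lam i ^ 2)) = _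
  have hIcc : Finset.Ioc 1 k = Finset.Icc 2 k := by
    ext i
    rw [Finset.mem_Ioc, Finset.mem_Icc]
    omega
  rw [← Finset.mul_prod_Ioc_eq_prod_Icc hk, h1, Real.sq_sqrt (by positivity), hIcc]
  ring

end Graph.IsSemiregularBipartite

/-! ### The formula for the join. -/

theorem theorem4p1 {α₁ β₁ α₂ β₂ : Type*} [DecidableEq α₁] [DecidableEq α₂]
    (G₁ : Graph α₁ β₁) (G₂ : Graph α₂ β₂)
    [Fintype G₁.vertexSet] [Fintype G₂.vertexSet]
    (hE₁ : G₁.edgeSet.Finite) (hE₂ : G₂.edgeSet.Finite)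
    (V₁ V₂ : Set α₁) (V₃ V₄ : Set α₂)
    (q₁ q₂ q₃ q₄ n₁ n₂ n₃ n₄ ν₁ ν₂ k₁ k₂ : ℕ) (lam mu : ℕ → ℝ)
    (hG₁ : G₁.IsSemiregularBipartite V₁ V₂ q₁ q₂)
    (hG₂ : G₂.IsSemiregularBipartite V₃ V₄ q₃ q₄)
    (hq₁ : 0 < q₁) (hq₃ : 0 < q₃)
    (hn₁ : V₁.ncard = n₁) (hn₂ : V₂.ncard = n₂)
    (hn₃ : V₃.ncard = n₃) (hn₄ : V₄.ncard = n₄)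
    (hν₁ : ν₁ = n₁ + n₂) (hν₂ : ν₂ = n₃ + n₄)
    (hlam : G₁.HasPositiveEigenvalues k₁ lam)
    (hmu : G₂.HasPositiveEigenvalues k₂ mu) :
    -- the exponents are genuine differences
    (k₁ ≤ n₁ ∧ k₁ ≤ n₂ ∧ k₂ ≤ n₃ ∧ k₂ ≤ n₄) ∧
    ((G₁.join G₂).numSpanningTrees : ℝ) =
      ((q₁ : ℝ) + q₂ + ν₂) * ((q₃ : ℝ) + q₄ + ν₁) *
      (((q₁ : ℝ) + ν₂) ^ (n₁ - k₁) * ((q₂ : ℝ) + ν₂) ^ (n₂ - k₁) *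
        ((q₃ : ℝ) + ν₁) ^ (n₃ - k₂) * ((q₄ : ℝ) + ν₁) ^ (n₄ - k₂)) *
      (∏ i ∈ Finset.Icc 2 k₁, (((q₁ : ℝ) + ν₂) * ((q₂ : ℝ) + ν₂) - lam i ^ 2)) *
      (∏ j ∈ Finset.Icc 2 k₂, (((q₃ : ℝ) + ν₁) * ((q₄ : ℝ) + ν₁) - mu j ^ 2)) := by
  have hk := hG₁.numPositiveEigenvalues_le hlam
  have hk' := hG₂.numPositiveEigenvalues_le hmu
  have hc := hG₁.card_vertexSet
  have hc' := hG₂.card_vertexSet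
  rw [hn₁, hn₂] at hk hc
  rw [hn₃, hn₄] at hk' hc'
  rw [← hν₁] at hc
  rw [← hν₂] at hc'
  refine ⟨⟨hk.1, hk.2, hk'.1, hk'.2⟩, ?_⟩
  have : Nonempty G₁.vertexSet :=
    hG₁.nonempty_left.elim fun x hx => ⟨x, hG₁.union_eq ▸ Or.inl hx⟩
  have : Nonempty G₂.vertexSet :=
    hG₂.nonempty_left.elim fun x hx => ⟨x, hG₂.union_eq ▸ Or.inl hx⟩
  have hpos₁ : (0 : ℝ) < ν₁ := by
    rw [← hc]
    exact Nat.cast_pos.mpr Fintype.card_pos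
  have hpos₂ : (0 : ℝ) < ν₂ := by
    rw [← hc']
    exact Nat.cast_pos.mpr Fintype.card_pos
  have h := Graph.numSpanningTrees_join hE₁ hE₂
  rw [hc, hc', hG₁.det_laplacianMatrix_add_smul_one hE₁ hq₁ hlam hpos₂,
    hG₂.det_laplacianMatrix_add_smul_one hE₂ hq₃ hmu hpos₁, hn₁, hn₂, hn₃, hn₄] at h
  -- The determinants were taken at `c = ν₂` and `c = ν₁`; these split-off factors match the product
  -- of the orders in front of the tree count.
  apply mul_left_cancel₀ (mul_pos hpos₁ hpos₂).ne'
  rw [h]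
  ring
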